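/- Let $p$ be a prime number and let $P=\sum_{i=1}^{p-1}\frac{(p-1)!}{i!\,(p-i)!}X^iY^{p-i}\in\mathbf Z[X,Y]$. For a commutative ring $A$ and an $A$-module $M$, a map $w\colon A\to M$ is called a Frobenius–Witt derivation if $$w(a+b)=w(a)+w(b)-P(a,b)\,w(p),\qquad w(ab)=b^p\,w(a)+a^p\,w(b)$$ for all $a,b\in A$. Let $w\colon A\to F\Omega^1_A$ be the universal Frobenius–Witt derivation; that is, $F\Omega^1_A$ is the quotient of the free $A$-module on symbols $[a]$, $a\in A$, by the submodule generated by the elements $[a+b]-[a]-[b]+P(a,b)[p]$ and $[ab]-a^p[b]-b^p[a]$, and $w(a)$ is the class of $[a]$. Let $A$ be a (not necessarily noetherian) local ring whose residue field $k$ has characteristic $p>0$. Let $g\colon A\to k$ be the canonical surjection and let $L_{k/A}$ denote the cotangent complex of $k$ over $A$, where $k$ is regarded as an $A$-algebra by the composition $F\circ g\colon A\to k$, $a\mapsto g(a)^p$, of $g$ with the Frobenius $F$ of $k$. Thus $H_1(L_{k/A})$ is the kernel of $I/I^2\to\Omega^1_{A[X_e\mid e\in k]/A}\otimes_{A[X_e\mid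 e\in k]} k$, where $I$ is the kernel of the $A$-algebra map $A[X_e\mid e\in k]\to k$, $X_e\mapsto e$. For $u\in A$, let $w(u)\in H_1(L_{k/A})$ be the class of $u-X_{g(u)}^p\in I$; equivalently, $w(u)$ is the image of the class of $u-T^p$ in $H_1(L_{W/A})$, $W=A[T]/(u-T^p,p)$, under the $A$-algebra map $W\to k$, $T\mapsto g(u)$. The map $A\to H_1(L_{k/A})$, $u\mapsto w(u)$, is a Frobenius–Witt derivation, where $A$ acts on the $k$-vector space $H_1(L_{k/A})$ through $g$. Hence it induces a canonical $k$-linear map $$F\Omega^1_A\otimes_{A,g}k\longrightarrow H_1(L_{k/A}),\qquad w(u)\otimes 1\mapsto w(u).$$ This map is an isomorphism. -/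

import Mathlib

open scoped TensorProduct

noncomputable section

namespace FrobWitt

universe u v w

/-- The value `P(a, b)` of the integral polynomial
`P = ∑_{i=1}^{p-1} (p-1)! / (i! (p-i)!) X^i Y^(p-i)`. For prime `p` and `0 < i < p` the division
of natural numbers in the coefficient is exact. -/
def polyP (p : ℕ) {R : Type u} [CommRing R] (a b : R) : R :=
  ∑ i ∈ Finset.Ioo 0 p,
    (((p - 1).factorial / (i.factorial * (p - i).factorial) : ℕ) : R) * a ^ i * b ^ (p - i)

/-- Frobenius-Witt derivations (for the prime number `p`) of a ring `A` with values in an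
`A`-module `M`. -/
structure IsFWDerivation (p : ℕ) {A : Type u} [CommRing A] {M : Type v} [AddCommGroup M]
    [Module A M] (w : A → M) : Prop where
  map_add : ∀ a b : A, w (a + b) = w a + w b - polyP p a b • w (p : A)
  map_mul : ∀ a b : A, w (a * b) = b ^ p • w a + a ^ p • w b

section Differentials

variable (p : ℕ) (A : Type u) [CommRing A]

/-- The submodule of the free module on the set `A` generated by
`[a + b] - [a] - [b] + P(a, b) [p]` and `[a b] - a^p [b] - b^p [a]`. -/
def relations : Submodule A (A →₀ A) :=
  Submodule.span A
    ((Set.range fun x : A × A =>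
        Finsupp.single (x.1 + x.2) (1 : A) - Finsupp.single x.1 1 - Finsupp.single x.2 1
          + polyP p x.1 x.2 • Finsupp.single (p : A) 1) ∪
     (Set.range fun x : A × A =>
        Finsupp.single (x.1 * x.2) (1 : A) - x.1 ^ p • Finsupp.single x.2 1
          - x.2 ^ p • Finsupp.single x.1 1))

/-- The module `FΩ¹_A` of Frobenius-Witt differentials. -/
def FWDifferentials : Type u := (A →₀ A) ⧸ relations p A

instance : AddCommGroup (FWDifferentials p A) :=
  inferInstanceAs (AddCommGroup ((A →₀ A) ⧸ relations p A))

instance : Module A (FWDifferentials p A) :=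
  inferInstanceAs (Module A ((A →₀ A) ⧸ relations p A))

variable {A}

/-- The universal Frobenius-Witt derivation `A → FΩ¹_A`. -/
def FWDifferentials.w (a : A) : FWDifferentials p A :=
  (relations p A).mkQ (Finsupp.single a 1)

theorem FWDifferentials.isFWDerivation_w :
    IsFWDerivation p (FWDifferentials.w p : A → FWDifferentials p A) where
  map_add a b := by
    have h := (Submodule.Quotient.mk_eq_zero (relations p A)).2
      (Submodule.subset_span (Or.inl ⟨(a, b), rfl⟩))
    change (relations p A).mkQ _ = 0 at h
    simp only [_root_.map_add, map_sub, map_smul] at h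
    change w p (a + b) - w p a - w p b + polyP p a b • w p (p : A) = 0 at h
    rw [← sub_eq_zero, ← h]
    abel
  map_mul a b := by
    have h := (Submodule.Quotient.mk_eq_zero (relations p A)).2
      (Submodule.subset_span (Or.inr ⟨(a, b), rfl⟩))
    change (relations p A).mkQ _ = 0 at h
    simp only [map_sub, map_smul] at h
    change w p (a * b) - a ^ p • w p b - b ^ p • w p a = 0 at h
    rw [← sub_eq_zero, ← h]
    abel

variable {M : Type v} [AddCommGroup M] [Module A M]

/-- The `A`-linear map `FΩ¹_A → M` with `w a ↦ d a` that corresponds to a Frobenius-Witt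
derivation `d : A → M` by the universal property of `FΩ¹_A`. -/
def FWDifferentials.lift (d : A → M) (hd : IsFWDerivation p d) : FWDifferentials p A →ₗ[A] M :=
  (relations p A).liftQ (Finsupp.linearCombination A d) (by
    refine Submodule.span_le.2 ?_
    rintro _ (⟨⟨a, b⟩, rfl⟩ | ⟨⟨a, b⟩, rfl⟩)
    · simp only [SetLike.mem_coe, LinearMap.mem_ker, _root_.map_add, map_sub, map_smul,
        Finsupp.linearCombination_single, one_smul, hd.map_add a b]
      abel
    · simp only [SetLike.mem_coe, LinearMap.mem_ker, map_sub, map_smul,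
        Finsupp.linearCombination_single, one_smul, hd.map_mul a b]
      abel)

theorem FWDifferentials.lift_w (d : A → M) (hd : IsFWDerivation p d) (a : A) :
    FWDifferentials.lift p d hd (FWDifferentials.w p a) = d a := by
  refine ((relations p A).liftQ_apply _ _).trans ?_
  simp

end Differentials

theorem add_pow_eq_polyP (p : ℕ) (hp : p.Prime) {R : Type u} [CommRing R] (a b : R) :
    (a + b) ^ p = a ^ p + b ^ p + (p : R) * polyP p a b := by
  obtain ⟨q, rfl⟩ : ∃ q, p = q + 1 := ⟨p - 1, (Nat.succ_pred_eq_of_pos hp.pos).symm⟩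
  have hI : Finset.Ioo 0 (q + 1) = (Finset.range (q + 1)).erase 0 := by
    ext i
    simp only [Finset.mem_Ioo, Finset.mem_erase, Finset.mem_range]
    omega
  rw [add_pow, Finset.sum_range_succ, ← Finset.add_sum_erase (Finset.range (q + 1)) _
    (Finset.mem_range.2 (Nat.succ_pos q)), ← hI]
  have h : ∑ i ∈ Finset.Ioo 0 (q + 1), a ^ i * b ^ (q + 1 - i) * ((q + 1).choose i : R)
      = ((q + 1 : ℕ) : R) * polyP (q + 1) a b := by
    rw [polyP, Finset.mul_sum]
    refine Finset.sum_congr rfl fun i hi => ?_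
    rw [Finset.mem_Ioo] at hi
    have hc : (q + 1).choose i
        = (q + 1) * ((q + 1 - 1).factorial / (i.factorial * (q + 1 - i).factorial)) := by
      have h1 := Nat.choose_mul_factorial_mul_factorial hi.2.le
      obtain ⟨c, h2⟩ := hp.dvd_choose_self hi.1.ne' hi.2
      have h3 : q.factorial = c * (i.factorial * (q + 1 - i).factorial) := by
        rw [h2, Nat.factorial_succ q] at h1
        apply Nat.eq_of_mul_eq_mul_left (Nat.succ_pos q)
        rw [← h1, Nat.succ_eq_add_one]
        ring
      rw [h2, Nat.add_sub_cancel, h3, Nat.mul_div_cancel _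
        (Nat.mul_pos (Nat.factorial_pos _) (Nat.factorial_pos _))]
    rw [hc]
    push_cast
    ring
  rw [h]
  simp
  ring

theorem map_polyP (p : ℕ) {R : Type u} {S : Type v} [CommRing R] [CommRing S] (f : R →+* S)
    (a b : R) : f (polyP p a b) = polyP p (f a) (f b) := by
  simp [polyP]

section Cotangent

variable {p : ℕ} {A : Type u} {E : Type v} [CommRing A] [CommRing E]

section Algebra

variable [Algebra A E]

theorem sub_pow_mem_ker (Q : Algebra.Extension.{w} A E) (u : A) (y : Q.Ring)
    (h : algebraMap A E u = algebraMap Q.Ring E y ^ p) :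
    algebraMap A Q.Ring u - y ^ p ∈ Q.ker := by
  rw [Algebra.Extension.ker, RingHom.mem_ker, map_sub, map_pow, ← h,
    ← IsScalarTower.algebraMap_apply, sub_self]

variable [CharP E p]

/-- Let `Q → E` be a surjection of `A`-algebras with kernel `I`, where `p = 0` in `E`, let `u ∈ A`
and let `y ∈ Q` be such that `u = y ^ p` in `E`. This is the class of `u - y ^ p ∈ I` in the kernel
of `d : I / I² → Ω¹_{Q/A} ⊗ E`. -/
def extClass (Q : Algebra.Extension.{w} A E) (u : A) (y : Q.Ring)
    (h : algebraMap A E u = algebraMap Q.Ring E y ^ p) : Q.H1Cotangent :=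
  ⟨Algebra.Extension.Cotangent.mk ⟨algebraMap A Q.Ring u - y ^ p, sub_pow_mem_ker Q u y h⟩, by
    rw [LinearMap.mem_ker, Algebra.Extension.cotangentComplex_mk, map_sub, Derivation.map_algebraMap,
      Derivation.leibniz_pow, zero_sub, TensorProduct.tmul_neg, ← Nat.cast_smul_eq_nsmul Q.Ring,
      ← TensorProduct.smul_tmul, ← algebraMap_smul E (p : Q.Ring) (1 : E), map_natCast,
      CharP.cast_eq_zero, zero_smul, TensorProduct.zero_tmul, neg_zero]⟩

theorem extClass_congr (hp : p.Prime) (Q : Algebra.Extension.{w} A E) {u : A} {y y' : Q.Ring}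
    (h : algebraMap A E u = algebraMap Q.Ring E y ^ p)
    (h' : algebraMap A E u = algebraMap Q.Ring E y' ^ p)
    (hy : algebraMap Q.Ring E y = algebraMap Q.Ring E y') :
    extClass Q u y h = extClass Q u y' h' := by
  apply Subtype.ext
  refine (Algebra.Extension.Cotangent.mk_eq_mk_iff_sub_mem _ _).2 ?_
  obtain ⟨z, hz, rfl⟩ : ∃ z ∈ Q.ker, y = y' + z :=
    ⟨y - y', by rw [Algebra.Extension.ker, RingHom.mem_ker, map_sub, hy, sub_self], by ring⟩
  have hpk : (p : Q.Ring) ∈ Q.ker := by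
    rw [Algebra.Extension.ker, RingHom.mem_ker, map_natCast, CharP.cast_eq_zero]
  have hP : polyP p y' z ∈ Q.ker := by
    refine Ideal.sum_mem _ fun i hi => Ideal.mul_mem_left _ _ (Ideal.pow_mem_of_mem _ hz _ ?_)
    rw [Finset.mem_Ioo] at hi
    omega
  have e : algebraMap A Q.Ring u - (y' + z) ^ p - (algebraMap A Q.Ring u - y' ^ p)
      = -(z ^ p + (p : Q.Ring) * polyP p y' z) := by
    rw [add_pow_eq_polyP p hp]
    ring
  rw [e]
  refine neg_mem (add_mem ?_ ?_)
  · exact Ideal.pow_le_pow_right hp.two_le (Ideal.pow_mem_pow hz p)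
  · rw [pow_two]
    exact Ideal.mul_mem_mul hpk hP

theorem cast_eq_zero_pow (hp : p.Prime) (Q : Algebra.Extension.{w} A E) :
    algebraMap A E (p : A) = algebraMap Q.Ring E 0 ^ p := by
  rw [map_natCast, CharP.cast_eq_zero, map_zero, zero_pow hp.ne_zero]

theorem extClass_add (hp : p.Prime) (Q : Algebra.Extension.{w} A E) {u u' : A} {y y' : Q.Ring}
    (h : algebraMap A E u = algebraMap Q.Ring E y ^ p)
    (h' : algebraMap A E u' = algebraMap Q.Ring E y' ^ p)
    (h'' : algebraMap A E (u + u') = algebraMap Q.Ring E (y + y') ^ p) :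
    extClass Q (u + u') (y + y') h'' = extClass Q u y h + extClass Q u' y' h'
      - algebraMap Q.Ring E (polyP p y y') • extClass Q (p : A) 0 (cast_eq_zero_pow hp Q) := by
  apply Subtype.ext
  change Algebra.Extension.Cotangent.mk _ = Algebra.Extension.Cotangent.mk _
    + Algebra.Extension.Cotangent.mk _
    - algebraMap Q.Ring E (polyP p y y') • Algebra.Extension.Cotangent.mk _
  rw [algebraMap_smul, ← map_smul, ← map_add, ← map_sub]
  congr 1
  apply Subtype.ext
  change algebraMap A Q.Ring (u + u') - (y + y') ^ p = (algebraMap A Q.Ring u - y ^ p)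
    + (algebraMap A Q.Ring u' - y' ^ p) - polyP p y y' * (algebraMap A Q.Ring (p : A) - 0 ^ p)
  rw [add_pow_eq_polyP p hp, map_add, map_natCast, zero_pow hp.ne_zero]
  ring

theorem extClass_mul (Q : Algebra.Extension.{w} A E) {u u' : A} {y y' : Q.Ring}
    (h : algebraMap A E u = algebraMap Q.Ring E y ^ p)
    (h' : algebraMap A E u' = algebraMap Q.Ring E y' ^ p)
    (h'' : algebraMap A E (u * u') = algebraMap Q.Ring E (y * y') ^ p) :
    extClass Q (u * u') (y * y') h'' =
      algebraMap Q.Ring E y' ^ p • extClass Q u y h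
        + algebraMap Q.Ring E y ^ p • extClass Q u' y' h' := by
  rw [← h', ← map_pow]
  apply Subtype.ext
  change Algebra.Extension.Cotangent.mk _ = algebraMap A E u' • Algebra.Extension.Cotangent.mk _
    + algebraMap Q.Ring E (y ^ p) • Algebra.Extension.Cotangent.mk _
  rw [IsScalarTower.algebraMap_apply A Q.Ring E, algebraMap_smul E (algebraMap A Q.Ring u'),
    algebraMap_smul E (y ^ p), ← map_smul, ← map_smul, ← map_add]
  congr 1
  apply Subtype.ext
  change algebraMap A Q.Ring (u * u') - (y * y') ^ p =
    algebraMap A Q.Ring u' * (algebraMap A Q.Ring u - y ^ p)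
      + y ^ p * (algebraMap A Q.Ring u' - y' ^ p)
  rw [map_mul]
  ring

theorem extClass_lift_add (hp : p.Prime) (Q : Algebra.Extension.{w} A E) (x : E → Q.Ring)
    (hx : ∀ e, algebraMap Q.Ring E (x e) = e) {u u' : A} {v v' : E}
    (h : algebraMap A E u = algebraMap Q.Ring E (x v) ^ p)
    (h' : algebraMap A E u' = algebraMap Q.Ring E (x v') ^ p)
    (h0 : algebraMap A E (p : A) = algebraMap Q.Ring E (x 0) ^ p)
    (h'' : algebraMap A E (u + u') = algebraMap Q.Ring E (x (v + v')) ^ p) :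
    extClass Q (u + u') (x (v + v')) h'' =
      extClass Q u (x v) h + extClass Q u' (x v') h' - polyP p v v' • extClass Q (p : A) (x 0) h0 := by
  have hs : algebraMap Q.Ring E (x (v + v')) = algebraMap Q.Ring E (x v + x v') := by
    rw [map_add, hx, hx, hx]
  rw [extClass_congr hp Q h'' (hs ▸ h'') hs, extClass_add hp Q h h',
    extClass_congr hp Q h0 (cast_eq_zero_pow hp Q) (by rw [hx, map_zero]), map_polyP, hx, hx]

theorem extClass_lift_mul (hp : p.Prime) (Q : Algebra.Extension.{w} A E) (x : E → Q.Ring)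
    (hx : ∀ e, algebraMap Q.Ring E (x e) = e) {u u' : A} {v v' : E}
    (h : algebraMap A E u = algebraMap Q.Ring E (x v) ^ p)
    (h' : algebraMap A E u' = algebraMap Q.Ring E (x v') ^ p)
    (h'' : algebraMap A E (u * u') = algebraMap Q.Ring E (x (v * v')) ^ p) :
    extClass Q (u * u') (x (v * v')) h'' =
      v' ^ p • extClass Q u (x v) h + v ^ p • extClass Q u' (x v') h' := by
  have hs : algebraMap Q.Ring E (x (v * v')) = algebraMap Q.Ring E (x v * x v') := by
    rw [map_mul, hx, hx, hx]
  rw [extClass_congr hp Q h'' (hs ▸ h'') hs, extClass_mul Q h h']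
  simp only [hx]

/-- Let `u ∈ A` and `v ∈ E` satisfy `u = v ^ p` in `E`, where `p = 0` in `E`. This is the class
`w(u, v) ∈ H₁(L_{E/A})`: the image of the class of `u - T ^ p` under
`A[T] → A[X_e | e ∈ E]`, `T ↦ X_v`, where `H₁(L_{E/A})` is computed by
`A[X_e | e ∈ E] → E`, `X_e ↦ e`. -/
def wClass (u : A) (v : E) (h : algebraMap A E u = v ^ p) : Algebra.H1Cotangent A E :=
  extClass (Algebra.Generators.self A E).toExtension u (MvPolynomial.X v : MvPolynomial E A)
    (h.trans (congrArg (· ^ p) (MvPolynomial.aeval_X (R := A) (id : E → E) v).symm))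

theorem wClass_add (hp : p.Prime) {u u' : A} {v v' : E}
    (h : algebraMap A E u = v ^ p) (h' : algebraMap A E u' = v' ^ p)
    (h0 : algebraMap A E (p : A) = 0 ^ p) (h'' : algebraMap A E (u + u') = (v + v') ^ p) :
    wClass (u + u') (v + v') h'' =
      wClass u v h + wClass u' v' h' - polyP p v v' • wClass (p : A) 0 h0 :=
  extClass_lift_add hp (Algebra.Generators.self A E).toExtension
    (fun e => (MvPolynomial.X e : MvPolynomial E A)) (MvPolynomial.aeval_X (R := A) (id : E → E))
    _ _ _ _

theorem wClass_mul (hp : p.Prime) {u u' : A} {v v' : E}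
    (h : algebraMap A E u = v ^ p) (h' : algebraMap A E u' = v' ^ p)
    (h'' : algebraMap A E (u * u') = (v * v') ^ p) :
    wClass (u * u') (v * v') h'' = v' ^ p • wClass u v h + v ^ p • wClass u' v' h' :=
  extClass_lift_mul hp (Algebra.Generators.self A E).toExtension
    (fun e => (MvPolynomial.X e : MvPolynomial E A)) (MvPolynomial.aeval_X (R := A) (id : E → E))
    _ _ _

end Algebra

section RingHom

/-- `H₁(L_{E/A})`, where `E` is regarded as an `A`-algebra by `f`. -/
def H1 (f : A →+* E) : Type (max u v) :=
  letI := f.toAlgebra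
  Algebra.H1Cotangent A E

instance (f : A →+* E) : AddCommGroup (H1 f) :=
  letI := f.toAlgebra
  (inferInstance : AddCommGroup (Algebra.H1Cotangent A E))

instance (f : A →+* E) : Module E (H1 f) :=
  letI := f.toAlgebra
  (inferInstance : Module E (Algebra.H1Cotangent A E))

/-- The class `w(u, v) ∈ H₁(L_{E/A})` for `u ∈ A` and `v ∈ E` with `f u = v ^ p`. -/
def H1.w [CharP E p] (f : A →+* E) (u : A) (v : E) (h : f u = v ^ p) : H1 f :=
  letI := f.toAlgebra
  wClass (p := p) u v h

theorem H1.w_congr [CharP E p] (f : A →+* E) {u : A} {v v' : E} (h : f u = v ^ p) (e : v = v') :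
    H1.w f u v h = H1.w f u v' (e ▸ h) := by
  subst e
  rfl

theorem H1.w_add [CharP E p] (hp : p.Prime) (f : A →+* E) {u u' : A} {v v' : E}
    (h : f u = v ^ p) (h' : f u' = v' ^ p) (h0 : f (p : A) = 0 ^ p)
    (h'' : f (u + u') = (v + v') ^ p) :
    H1.w f (u + u') (v + v') h'' =
      H1.w f u v h + H1.w f u' v' h' - polyP p v v' • H1.w f (p : A) 0 h0 :=
  letI := f.toAlgebra
  wClass_add hp h h' h0 h''

theorem H1.w_mul [CharP E p] (hp : p.Prime) (f : A →+* E) {u u' : A} {v v' : E}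
    (h : f u = v ^ p) (h' : f u' = v' ^ p) (h'' : f (u * u') = (v * v') ^ p) :
    H1.w f (u * u') (v * v') h'' = v' ^ p • H1.w f u v h + v ^ p • H1.w f u' v' h' :=
  letI := f.toAlgebra
  wClass_mul hp h h' h''

end RingHom

section Frobenius

variable (p A E) [Fact p.Prime] [CharP E p] [Algebra A E]

/-- `H₁(L_{E/A})`, where `E` is regarded as an `A`-algebra by the composition `A → E → E`
of the given map with the absolute Frobenius of `E`. -/
def FrobeniusH1 : Type (max u v) :=
  H1 ((frobenius E p).comp (algebraMap A E))

instance : AddCommGroup (FrobeniusH1 p A E) :=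
  inferInstanceAs (AddCommGroup (H1 _))

instance : Module E (FrobeniusH1 p A E) :=
  inferInstanceAs (Module E (H1 _))

/-- The `A`-module structure by the given map `A → E`, without the Frobenius. -/
instance : Module A (FrobeniusH1 p A E) :=
  Module.compHom _ (algebraMap A E)

instance : IsScalarTower A E (FrobeniusH1 p A E) :=
  IsScalarTower.of_algebraMap_smul fun _ _ => rfl

variable {A}

/-- The map `A → H₁(L_{E/A})`, `u ↦ w(u, v)`, where `v` is the image of `u` by the given map
`A → E`. -/
def FrobeniusH1.w (u : A) : FrobeniusH1 p A E :=
  H1.w ((frobenius E p).comp (algebraMap A E)) u (algebraMap A E u) rfl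

/-- The map `A → H₁(L_{E/A})` above is a Frobenius-Witt derivation, if `A` acts on `H₁(L_{E/A})`
by the given map `A → E`. -/
theorem FrobeniusH1.isFWDerivation_w :
    IsFWDerivation p (FrobeniusH1.w p E : A → FrobeniusH1 p A E) := by
  have hp : p.Prime := Fact.out
  let f : A →+* E := (frobenius E p).comp (algebraMap A E)
  have h0 : f (p : A) = (0 : E) ^ p := by
    rw [map_natCast, CharP.cast_eq_zero, zero_pow hp.ne_zero]
  constructor
  · intro a b
    have h1 : FrobeniusH1.w p E (a + b) = _ := H1.w_congr f rfl (map_add (algebraMap A E) a b)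
    have h2 : FrobeniusH1.w p E (p : A) = _ := H1.w_congr f (v' := 0) rfl
      (by rw [map_natCast, CharP.cast_eq_zero])
    rw [h1, h2]
    change (_ : FrobeniusH1 p A E) = FrobeniusH1.w p E a + FrobeniusH1.w p E b
      - algebraMap A E (polyP p a b) • (_ : FrobeniusH1 p A E)
    rw [map_polyP]
    exact H1.w_add hp f rfl rfl h0 _
  · intro a b
    have h1 : FrobeniusH1.w p E (a * b) = _ := H1.w_congr f rfl (map_mul (algebraMap A E) a b)
    rw [h1]
    change (_ : H1 f) = algebraMap A E (b ^ p) • FrobeniusH1.w p E a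
      + algebraMap A E (a ^ p) • FrobeniusH1.w p E b
    rw [map_pow, map_pow]
    exact H1.w_mul hp f rfl rfl _

variable (A) in
/-- The canonical `E`-linear map `FΩ¹_A ⊗_A E → H₁(L_{E/A})`, `w a ⊗ 1 ↦ w(a, v)` for the image
`v` of `a` in `E`. -/
def toFrobeniusH1 : E ⊗[A] FWDifferentials p A →ₗ[E] FrobeniusH1 p A E :=
  LinearMap.liftBaseChange E
    (FWDifferentials.lift p (FrobeniusH1.w p E) (FrobeniusH1.isFWDerivation_w p E))

theorem toFrobeniusH1_tmul (e : E) (a : A) :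
    toFrobeniusH1 p A E (e ⊗ₜ FWDifferentials.w p a) = e • FrobeniusH1.w p E a := by
  rw [toFrobeniusH1, LinearMap.liftBaseChange_tmul, FWDifferentials.lift_w]

end Frobenius

end Cotangent

end FrobWitt

end

open scoped TensorProduct

noncomputable section

namespace FrobWitt

universe u v w

/-! The residue field plays no special role: any ring map `g : A → E` to a field of characteristic
`p` will do. Surjectivity (`span_extClass_eq_top`): let I be the kernel of A[X_e] → E and J ⊆ I the
ideal containing I² generated modulo I² by the classes w(u). Modulo J one has p = 0 and u =
X_{g(u)}^p. As E is formally smooth over F_p, the square-zero extension A[X_e]/J → E splits, and the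
splitting is automatically A-linear because p-th powers do not depend on the lift. Hence H₁ maps to
zero in I/J. Injectivity (`exists_linearMap_wClass`): a Frobenius-Witt derivation d into a vector
space N over a perfect field K ⊇ E amounts to a ring map a ↦ (g(a)^p, d(a)) into a Witt-vector-like
extension of K by N. Sending X_e to the Teichmüller lift of e extends it to A[X_e]; on I this gives
a linear map I/I² → N with w(u) ↦ d(u). Taking N = K ⊗ FΩ¹_A and an E-linear retraction K → E yields
a left inverse. -/

/-! ### Identities for P. -/

theorem polyP_comm (p : ℕ) {R : Type u} [CommRing R] (a b : R) : polyP p a b = polyP p b a := by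
  refine Finset.sum_nbij' (fun i => p - i) (fun i => p - i) ?_ ?_ ?_ ?_ ?_
  · intro i hi
    simp only [Finset.mem_Ioo] at hi ⊢
    omega
  · intro i hi
    simp only [Finset.mem_Ioo] at hi ⊢
    omega
  · intro i hi
    simp only [Finset.mem_Ioo] at hi
    omega
  · intro i hi
    simp only [Finset.mem_Ioo] at hi
    omega
  · intro i hi
    simp only [Finset.mem_Ioo] at hi
    rw [Nat.sub_sub_self hi.2.le, mul_comm (p - i).factorial]
    ring

theorem polyP_zero_right (p : ℕ) {R : Type u} [CommRing R] (a : R) : polyP p a 0 = 0 := by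
  refine Finset.sum_eq_zero fun i hi => ?_
  rw [Finset.mem_Ioo] at hi
  rw [zero_pow (by omega), mul_zero]

theorem polyP_zero_left (p : ℕ) {R : Type u} [CommRing R] (a : R) : polyP p 0 a = 0 := by
  rw [polyP_comm, polyP_zero_right]

/-- P is homogeneous of degree p; this becomes distributivity in the twisted extension. -/
theorem polyP_mul (p : ℕ) {R : Type u} [CommRing R] (c a b : R) :
    polyP p (c * a) (c * b) = c ^ p * polyP p a b := by
  rw [polyP, polyP, Finset.mul_sum]
  refine Finset.sum_congr rfl fun i hi => ?_
  rw [Finset.mem_Ioo] at hi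
  obtain ⟨j, rfl⟩ := Nat.exists_eq_add_of_lt hi.2
  rw [show i + j + 1 - i = j + 1 by omega]
  ring

/-- The polynomial `P` is an additive two-cocycle. -/
theorem polyP_cocycle (p : ℕ) (hp : p.Prime) {R : Type u} [CommRing R] (a b c : R) :
    polyP p a b + polyP p (a + b) c = polyP p b c + polyP p a (b + c) := by
  -- Over ℤ, p can be cancelled, and p times the identity is the expansion of (x + y + z)^p in two
  -- ways. The general case follows by specialization.
  have key : ∀ x y z : MvPolynomial (Fin 3) ℤ,
      polyP p x y + polyP p (x + y) z = polyP p y z + polyP p x (y + z) := by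
    intro x y z
    have hp0 : (p : MvPolynomial (Fin 3) ℤ) ≠ 0 := Nat.cast_ne_zero.2 hp.ne_zero
    apply mul_left_cancel₀ hp0
    have h1 := add_pow_eq_polyP p hp x y
    have h2 := add_pow_eq_polyP p hp (x + y) z
    have h3 := add_pow_eq_polyP p hp y z
    have h4 := add_pow_eq_polyP p hp x (y + z)
    rw [← add_assoc] at h4
    linear_combination h4 + h3 - h1 - h2
  let f : MvPolynomial (Fin 3) ℤ →+* R := (MvPolynomial.aeval ![a, b, c]).toRingHom
  have h := congrArg f (key (.X 0) (.X 1) (.X 2))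
  simp only [map_add, map_polyP] at h
  simpa [f] using h

theorem IsFWDerivation.map_one {p : ℕ} {A : Type u} {N : Type v} [CommRing A] [AddCommGroup N]
    [Module A N] {d : A → N}
    (hd : IsFWDerivation p d) : d 1 = 0 := by
  have h := hd.map_mul 1 1
  rw [mul_one, one_pow, one_smul] at h
  exact left_eq_add.1 h

theorem IsFWDerivation.map_zero {p : ℕ} {A : Type u} {N : Type v} [CommRing A] [AddCommGroup N]
    [Module A N] {d : A → N}
    (hd : IsFWDerivation p d) : d 0 = 0 := by
  have h := hd.map_add 0 0
  rw [polyP_zero_left, zero_smul, sub_zero, add_zero] at h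
  exact left_eq_add.1 h

/-! ### Twisted square-zero extensions of a perfect field. -/

section TwistedExtension

variable (p : ℕ) (K : Type u) [Field K] {N : Type v} [AddCommGroup N] [Module K N]

/-- The square-zero extension of a perfect field `K` of characteristic `p` by a vector space `N` in
which `p` is equal to a given element `c` of `N`, with underlying set `K × N`. -/
@[nolint unusedArguments]
def TwistedExtension (_ : ℕ) (K : Type u) {N : Type v} (_ : N) : Type (max u v) := K × N

namespace TwistedExtension

variable {K} {c : N}

@[ext]
theorem ext {K : Type u} {N : Type v} {c : N} {x y : TwistedExtension p K c}
    (h1 : x.1 = y.1) (h2 : x.2 = y.2) : x = y :=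
  Prod.ext h1 h2

variable [Fact p.Prime] [CharP K p] [PerfectRing K p]

/-- The cocycle which defines the addition. -/
def cocycle (x y : K) : K :=
  polyP p ((frobeniusEquiv K p).symm x) ((frobeniusEquiv K p).symm y)

theorem cocycle_comm (x y : K) : cocycle p x y = cocycle p y x := polyP_comm _ _ _

theorem cocycle_zero_left (x : K) : cocycle p 0 x = 0 := by
  rw [cocycle, map_zero, polyP_zero_left]

theorem cocycle_zero_right (x : K) : cocycle p x 0 = 0 := by
  rw [cocycle, map_zero, polyP_zero_right]

theorem cocycle_assoc (x y z : K) :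
    cocycle p x y + cocycle p (x + y) z = cocycle p y z + cocycle p x (y + z) := by
  simp only [cocycle, map_add]
  exact polyP_cocycle p Fact.out _ _ _

/-- The p-th roots in `cocycle` turn homogeneity of degree p into degree 1. -/
theorem cocycle_mul (z x y : K) : cocycle p (z * x) (z * y) = z * cocycle p x y := by
  simp only [cocycle, map_mul, polyP_mul, frobeniusEquiv_symm_pow_p]

theorem cocycle_pow (x y : K) : cocycle p (x ^ p) (y ^ p) = polyP p x y := by
  simp only [cocycle, ← frobenius_def, frobeniusEquiv_symm_apply_frobenius]

instance : Add (TwistedExtension p K c) where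
  add x y := (x.1 + y.1, x.2 + y.2 - cocycle p x.1 y.1 • c)

instance : Zero (TwistedExtension p K c) where
  zero := (0, 0)

instance : Neg (TwistedExtension p K c) where
  neg x := (-x.1, -x.2 + cocycle p x.1 (-x.1) • c)

/-- Associativity of addition is the cocycle identity, commutativity the symmetry of P, and
distributivity the homogeneity `cocycle_mul`. Multiplication is that of the trivial square-zero
extension. -/
instance : CommRing (TwistedExtension p K c) where
  mul x y := (x.1 * y.1, x.1 • y.2 + y.1 • x.2)
  one := (1, 0)
  nsmul := nsmulRec
  zsmul := zsmulRec
  add_assoc x y z := by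
    refine ext p (add_assoc x.1 y.1 z.1) ?_
    change x.2 + y.2 - cocycle p x.1 y.1 • c + z.2 - cocycle p (x.1 + y.1) z.1 • c
      = x.2 + (y.2 + z.2 - cocycle p y.1 z.1 • c) - cocycle p x.1 (y.1 + z.1) • c
    have h := congrArg (· • c) (cocycle_assoc p x.1 y.1 z.1)
    simp only [add_smul] at h
    rw [← sub_eq_zero] at h ⊢
    rw [← neg_eq_zero, ← h]
    abel
  add_comm x y := by
    refine ext p (add_comm x.1 y.1) ?_
    change x.2 + y.2 - _ = y.2 + x.2 - _
    rw [cocycle_comm, add_comm x.2]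
  zero_add x := by
    refine ext p (zero_add x.1) ?_
    change 0 + x.2 - cocycle p 0 x.1 • c = x.2
    rw [cocycle_zero_left, zero_smul, sub_zero, zero_add]
  add_zero x := by
    refine ext p (add_zero x.1) ?_
    change x.2 + 0 - cocycle p x.1 0 • c = x.2
    rw [cocycle_zero_right, zero_smul, sub_zero, add_zero]
  neg_add_cancel x := by
    refine ext p (neg_add_cancel x.1) ?_
    change -x.2 + cocycle p x.1 (-x.1) • c + x.2 - cocycle p (-x.1) x.1 • c = 0
    rw [cocycle_comm]
    abel
  mul_assoc x y z := by
    refine ext p (mul_assoc x.1 y.1 z.1) ?_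
    change (x.1 * y.1) • z.2 + z.1 • (x.1 • y.2 + y.1 • x.2)
      = x.1 • (y.1 • z.2 + z.1 • y.2) + (y.1 * z.1) • x.2
    module
  mul_comm x y := by
    refine ext p (mul_comm x.1 y.1) ?_
    change x.1 • y.2 + y.1 • x.2 = y.1 • x.2 + x.1 • y.2
    exact add_comm _ _
  one_mul x := by
    refine ext p (one_mul x.1) ?_
    change (1 : K) • x.2 + x.1 • (0 : N) = x.2
    module
  mul_one x := by
    refine ext p (mul_one x.1) ?_
    change x.1 • (0 : N) + (1 : K) • x.2 = x.2
    module
  zero_mul x := by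
    refine ext p (zero_mul x.1) ?_
    change (0 : K) • x.2 + x.1 • (0 : N) = 0
    module
  mul_zero x := by
    refine ext p (mul_zero x.1) ?_
    change x.1 • (0 : N) + (0 : K) • x.2 = 0
    module
  left_distrib x y z := by
    refine ext p (left_distrib x.1 y.1 z.1) ?_
    change x.1 • (y.2 + z.2 - cocycle p y.1 z.1 • c) + (y.1 + z.1) • x.2
      = (x.1 • y.2 + y.1 • x.2) + (x.1 • z.2 + z.1 • x.2) - cocycle p (x.1 * y.1) (x.1 * z.1) • c
    rw [cocycle_mul]
    module
  right_distrib x y z := by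
    refine ext p (right_distrib x.1 y.1 z.1) ?_
    change (x.1 + y.1) • z.2 + z.1 • (x.2 + y.2 - cocycle p x.1 y.1 • c)
      = (x.1 • z.2 + z.1 • x.2) + (y.1 • z.2 + z.1 • y.2) - cocycle p (x.1 * z.1) (y.1 * z.1) • c
    rw [mul_comm x.1, mul_comm y.1, cocycle_mul]
    module

theorem snd_add (x y : TwistedExtension p K c) :
    (x + y).2 = x.2 + y.2 - cocycle p x.1 y.1 • c := rfl

theorem snd_mul (x y : TwistedExtension p K c) : (x * y).2 = x.1 • y.2 + y.1 • x.2 := rfl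

variable (c) in
/-- The projection to `K`. -/
def fstHom : TwistedExtension p K c →+* K where
  toFun x := x.1
  map_zero' := rfl
  map_one' := rfl
  map_add' _ _ := rfl
  map_mul' _ _ := rfl

variable (c) in
/-- The Teichmüller section of the projection to `K`. -/
def teichmuller : K →* TwistedExtension p K c where
  toFun x := (x, 0)
  map_one' := rfl
  map_mul' x y := by
    refine ext p rfl ?_
    change (0 : N) = x • 0 + y • 0
    module

end TwistedExtension

variable {p} {K} [Fact p.Prime] [CharP K p] [PerfectRing K p]

/-- The ring homomorphism to a twisted extension that corresponds to a Frobenius-Witt derivation. -/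
def IsFWDerivation.toTwistedExtension {A : Type w} [CommRing A] [Module A N] {d : A → N}
    (hd : IsFWDerivation p d) (g : A →+* K) (hg : ∀ (a : A) (n : N), a • n = g a • n) :
    A →+* TwistedExtension p K (d (p : A)) where
  -- With g(a)^p as first component, the p-th roots in the cocycle give back P(g(a), g(b)), and the
  -- product rule of the extension becomes the Frobenius-twisted Leibniz rule.
  toFun a := (g a ^ p, d a)
  map_one' := TwistedExtension.ext p (by rw [RingHom.map_one, one_pow]; rfl) hd.map_one
  map_zero' := TwistedExtension.ext p
    (by rw [RingHom.map_zero, zero_pow (Fact.out : p.Prime).ne_zero]; rfl) hd.map_zero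
  map_mul' a b := TwistedExtension.ext p (by rw [RingHom.map_mul, mul_pow]; rfl) (by
    change d (a * b) = g a ^ p • d b + g b ^ p • d a
    rw [hd.map_mul, hg, hg, map_pow, map_pow, add_comm])
  map_add' a b := TwistedExtension.ext p (by rw [RingHom.map_add, add_pow_char]; rfl) (by
    change d (a + b) = d a + d b - TwistedExtension.cocycle p (g a ^ p) (g b ^ p) • d (p : A)
    rw [TwistedExtension.cocycle_pow, hd.map_add, hg, map_polyP])

end TwistedExtension

/-! ### Formal smoothness over a perfect field and splitting of square-zero extensions. -/

/-- Reduction to finitely generated extensions: a polynomial involves finitely many variables, which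
are themselves elements of L, so a cycle in I/I² already lives over the subfield they generate. -/
theorem subsingleton_h1Cotangent_of_perfectField (K : Type u) (L : Type v) [Field K] [Field L]
    [Algebra K L] [PerfectField K] : Subsingleton (Algebra.H1Cotangent K L) := by
  refine (Algebra.Extension.subsingleton_h1Cotangent _).2 ?_
  rw [injective_iff_map_eq_zero]
  suffices key : ∀ (f : MvPolynomial L K) (hf : f ∈ (Algebra.Generators.self K L).toExtension.ker),
      (Algebra.Generators.self K L).toExtension.cotangentComplex (.mk ⟨f, hf⟩) = 0 →
        (Algebra.Extension.Cotangent.mk ⟨f, hf⟩ :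
          (Algebra.Generators.self K L).toExtension.Cotangent) = 0 by
    intro x hx
    obtain ⟨y, rfl⟩ := Algebra.Extension.Cotangent.mk_surjective x
    exact key y.1 y.2 hx
  intro f hf hx
  let L₀ := IntermediateField.adjoin K (f.vars : Set L)
  have : Algebra.EssFiniteType K L₀ :=
    IntermediateField.essFiniteType_iff.2 ⟨f.vars, rfl⟩
  obtain ⟨f₀, hff₀⟩ := MvPolynomial.exists_rename_eq_of_vars_subset_range f (algebraMap L₀ L)
    (algebraMap L₀ L).injective
    (fun e he => ⟨⟨e, IntermediateField.subset_adjoin K _ he⟩, rfl⟩)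
  clear_value L₀
  subst hff₀
  have haeval : ∀ g : MvPolynomial L₀ K,
      MvPolynomial.aeval (id : L → L) (MvPolynomial.rename (algebraMap L₀ L) g)
        = algebraMap L₀ L (MvPolynomial.aeval (id : L₀ → L₀) g) := by
    intro g
    rw [MvPolynomial.aeval_rename]
    exact (MvPolynomial.aeval_algebraMap_apply L (id : L₀ → L₀) g)
  let P := Algebra.Generators.self K L
  let P₀ := Algebra.Generators.self K L₀
  have hf₀ : f₀ ∈ P₀.toExtension.ker := by
    have h : MvPolynomial.aeval (id : L → L) (MvPolynomial.rename (algebraMap L₀ L) f₀) = 0 := hf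
    rw [haeval, map_eq_zero] at h
    exact h
  -- The coordinates of df are the evaluated partial derivatives, and those of f₀ map into L to
  -- those of f at the same variables.
  have hd : P₀.toExtension.cotangentComplex (.mk ⟨f₀, hf₀⟩) = 0 := by
    apply P₀.cotangentSpaceBasis.repr.injective
    refine Finsupp.ext fun e => ?_
    have h := congrArg (fun y => P.cotangentSpaceBasis.repr y (algebraMap L₀ L e)) hx
    simp only [Algebra.Extension.cotangentComplex_mk] at h ⊢
    erw [Algebra.Generators.cotangentSpaceBasis_repr_one_tmul] at h
    erw [Algebra.Generators.cotangentSpaceBasis_repr_one_tmul]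
    rw [MvPolynomial.pderiv_rename (algebraMap L₀ L).injective] at h
    erw [haeval] at h
    rw [map_zero, Finsupp.zero_apply, map_eq_zero] at h
    rw [map_zero, Finsupp.zero_apply]
    exact h
  have hinj : Function.Injective P₀.toExtension.cotangentComplex :=
    (Algebra.Extension.subsingleton_h1Cotangent _).1
      (inferInstanceAs (Subsingleton (Algebra.H1Cotangent K L₀)))
  rw [injective_iff_map_eq_zero] at hinj
  have h0 := (Algebra.Extension.Cotangent.mk_eq_zero_iff _).1 (hinj _ hd)
  refine (Algebra.Extension.Cotangent.mk_eq_zero_iff _).2 ?_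
  let ρ : MvPolynomial L₀ K →ₐ[K] MvPolynomial L K := MvPolynomial.rename (algebraMap L₀ L)
  let I₀ : Ideal (MvPolynomial L₀ K) := RingHom.ker (MvPolynomial.aeval (R := K) (id : L₀ → L₀))
  let I : Ideal (MvPolynomial L K) := RingHom.ker (MvPolynomial.aeval (R := K) (id : L → L))
  have hI : I₀ ≤ I.comap ρ := by
    intro g hg
    change MvPolynomial.aeval (id : L → L) (MvPolynomial.rename (algebraMap L₀ L) g) = 0
    have hg' : MvPolynomial.aeval (id : L₀ → L₀) g = 0 := hg
    rw [haeval, hg', map_zero]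
  exact (Ideal.pow_right_mono hI 2).trans (Ideal.le_comap_pow ρ 2) h0

/-- Every extension of a perfect field is formally smooth. -/
theorem formallySmooth_of_perfectField (K : Type u) (L : Type v) [Field K] [Field L]
    [Algebra K L] [PerfectField K] : Algebra.FormallySmooth K L where
  projective_kaehlerDifferential := inferInstance
  subsingleton_h1Cotangent := subsingleton_h1Cotangent_of_perfectField K L

/-- A square-zero extension, with `p = 0`, of a field of characteristic `p` splits. -/
theorem exists_section_of_ker_sq_eq_bot {p : ℕ} [Fact p.Prime] {S : Type w} {E : Type v}
    [CommRing S] [Field E] [CharP E p] [CharP S p] (q : S →+* E) (hq : Function.Surjective q)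
    (hker : RingHom.ker q ^ 2 = ⊥) : ∃ s : E →+* S, ∀ e, q (s e) = e := by
  let := ZMod.algebra E p
  let := ZMod.algebra S p
  have := formallySmooth_of_perfectField (ZMod p) E
  let q' : S →ₐ[ZMod p] E := { q with commutes' := fun r => RingHom.congr_fun (RingHom.ext_zmod
    (q.comp (algebraMap (ZMod p) S)) (algebraMap (ZMod p) E)) r }
  have hnil : IsNilpotent (RingHom.ker (q' : S →+* E)) := ⟨2, hker⟩
  exact ⟨(Algebra.FormallySmooth.liftOfSurjective (AlgHom.id (ZMod p) E) q' hq hnil : E →+* S),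
    fun e => Algebra.FormallySmooth.liftOfSurjective_apply (AlgHom.id (ZMod p) E) q' hq hnil e⟩

/-- In characteristic p, x^p - y^p = (x - y)^p, which vanishes since p ≥ 2 and (x - y)² = 0. -/
theorem pow_eq_pow_of_ker_sq_eq_bot {p : ℕ} [Fact p.Prime] {S : Type w} {E : Type v}
    [CommRing S] [CommRing E] [CharP S p] (q : S →+* E)
    (hker : RingHom.ker q ^ 2 = ⊥) {x y : S} (h : q x = q y) : x ^ p = y ^ p := by
  have hxy : (x - y) ^ 2 = 0 := by
    rw [← Ideal.mem_bot, ← hker]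
    exact Ideal.pow_mem_pow (by rw [RingHom.mem_ker, map_sub, h, sub_self]) 2
  have h0 : (x - y) ^ p = 0 := pow_eq_zero_of_le (Fact.out : p.Prime).two_le hxy
  rwa [sub_pow_char, sub_eq_zero] at h0

/-! ### Generation of H₁ by the classes w(u). -/

section

variable {p : ℕ} [Fact p.Prime] {A : Type u} {E : Type v} [CommRing A] [Field E] [Algebra A E]
  [CharP E p]

theorem span_extClass_eq_top (g : A →+* E) (hg : ∀ a, algebraMap A E a = g a ^ p)
    (P : Algebra.Extension.{w} A E) (x : E → P.Ring) (hx : ∀ e, algebraMap P.Ring E (x e) = e) :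
    Submodule.span E (Set.range fun u => extClass P u (x (g u)) (by rw [hx, hg])) = ⊤ := by
  have hp : p.Prime := Fact.out
  let T := Submodule.span E (Set.range fun u => extClass P u (x (g u)) (by rw [hx, hg]))
  let T' : Submodule E P.Cotangent := T.map Algebra.Extension.h1Cotangentι
  -- The preimage of T' in I, viewed as an ideal of the whole ring; thus I² ≤ J ≤ I.
  let J : Ideal P.Ring :=
    ((T'.restrictScalars P.Ring).comap Algebra.Extension.Cotangent.mk).map P.ker.subtype
  have hJ : ∀ y : P.ker, (y : P.Ring) ∈ J ↔ Algebra.Extension.Cotangent.mk y ∈ T' := by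
    intro y
    constructor
    · rintro ⟨z, hz, hzy⟩
      obtain rfl : z = y := Subtype.ext hzy
      exact hz
    · exact fun hy => ⟨y, hy, rfl⟩
  have hle : J ≤ P.ker := by
    rintro _ ⟨z, -, rfl⟩
    exact z.2
  have hsq : P.ker ^ 2 ≤ J := by
    intro z hz
    refine (hJ ⟨z, Ideal.pow_le_self two_ne_zero hz⟩).2 ?_
    rw [(Algebra.Extension.Cotangent.mk_eq_zero_iff _).2 hz]
    exact zero_mem _
  have hmem : ∀ u, algebraMap A P.Ring u - x (g u) ^ p ∈ J := fun u =>
    (hJ ⟨_, sub_pow_mem_ker P u (x (g u)) (by rw [hx, hg])⟩).2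
      ⟨_, Submodule.subset_span ⟨u, rfl⟩, rfl⟩
  let S := P.Ring ⧸ J
  let π : P.Ring →+* S := Ideal.Quotient.mk J
  let q : S →+* E := Ideal.Quotient.lift J (algebraMap P.Ring E) fun a ha => hle ha
  have hqπ : ∀ a, q (π a) = algebraMap P.Ring E a := fun a => rfl
  have hπ : Function.Surjective π := Ideal.Quotient.mk_surjective
  have hq : Function.Surjective q := fun e => ⟨π (x e), hx e⟩
  have hqker : RingHom.ker q ^ 2 = ⊥ := by
    have h1 : RingHom.ker q = P.ker.map π := by
      refine le_antisymm (fun a ha => ?_) (Ideal.map_le_iff_le_comap.2 fun a ha => ha)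
      obtain ⟨a, rfl⟩ := hπ a
      exact Ideal.mem_map_of_mem π ha
    rw [h1, ← Ideal.map_pow, ← le_bot_iff, Ideal.map_le_iff_le_comap]
    exact fun a ha => Ideal.Quotient.eq_zero_iff_mem.2 (hsq ha)
  have hπu : ∀ u, π (algebraMap A P.Ring u) = π (x (g u)) ^ p := fun u => by
    rw [← map_pow]
    exact Ideal.Quotient.eq.2 (hmem u)
  have hx0 : π (x 0) ^ p = 0 := by
    have h : π (x 0) ∈ RingHom.ker q := by rw [RingHom.mem_ker, hqπ, hx]
    refine pow_eq_zero_of_le hp.two_le ?_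
    rw [← Ideal.mem_bot, ← hqker]
    exact Ideal.pow_mem_pow h 2
  -- The relation u = x(g(u))^p for u = p, where g(p) = 0.
  have hpS : (p : S) = 0 := by
    have h := hπu (p : A)
    rwa [map_natCast, map_natCast, map_natCast, CharP.cast_eq_zero E p, hx0] at h
  have : Nontrivial S := q.domain_nontrivial
  have _ : CharP S p := (CharP.charP_iff_prime_eq_zero hp).2 hpS
  obtain ⟨s, hs⟩ := exists_section_of_ker_sq_eq_bot (p := p) q hq hqker
  -- Both s(g(a)) and π(x(g(a))) lift g(a), so their p-th powers agree; hence the section respects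
  -- the A-algebra structures.
  have hsA : ∀ a, s (algebraMap A E a) = π (algebraMap A P.Ring a) := by
    intro a
    rw [hg, map_pow, hπu]
    exact pow_eq_pow_of_ker_sq_eq_bot q hqker (by rw [hs, hqπ, hx])
  let : Algebra S E := q.toAlgebra
  let P' : Algebra.Extension.{w} A E :=
    { Ring := S
      algebra₂ := q.toAlgebra
      isScalarTower := IsScalarTower.of_algebraMap_eq fun a =>
        IsScalarTower.algebraMap_apply A P.Ring E a
      σ := fun e => π (x e)
      algebraMap_σ := hx }
  let f₁ : P.Hom P' :=
    { toRingHom := π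
      toRingHom_algebraMap := fun _ => rfl
      algebraMap_toRingHom := fun _ => rfl }
  let f₂ : P.Hom P' :=
    { toRingHom := s.comp (algebraMap P.Ring E)
      toRingHom_algebraMap := fun a => by
        change s (algebraMap P.Ring E (algebraMap A P.Ring a)) = π (algebraMap A P.Ring a)
        rw [← IsScalarTower.algebraMap_apply, hsA]
      algebraMap_toRingHom := fun a => hs _ }
  refine eq_top_iff.2 fun z _ => ?_
  -- Morphisms of extensions with the same source and target agree on H₁. As `f₂` factors through E,
  -- it kills I, so `f₁` kills H₁, which means that representatives of cycles lie in J.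
  have hz := congrArg Subtype.val
    (LinearMap.congr_fun (Algebra.Extension.H1Cotangent.map_eq f₁ f₂) z)
  obtain ⟨z, hz0⟩ := z
  obtain ⟨y, rfl⟩ := Algebra.Extension.Cotangent.mk_surjective z
  have hy : (y : P.Ring) ∈ J := by
    have h : (Algebra.Extension.Cotangent.mk ⟨π y, y.2⟩ : P'.Cotangent)
      = Algebra.Extension.Cotangent.mk ⟨s (algebraMap P.Ring E y), _⟩ := hz
    rw [Algebra.Extension.Cotangent.mk_eq_mk_iff_sub_mem] at h
    have h' : π y - s (algebraMap P.Ring E y) ∈ RingHom.ker q ^ 2 := h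
    rw [hqker, show algebraMap P.Ring E y = 0 from y.2, map_zero, sub_zero, Ideal.mem_bot] at h'
    exact Ideal.Quotient.eq_zero_iff_mem.1 h'
  obtain ⟨t, ht, hty⟩ := (hJ y).1 hy
  obtain rfl : t = ⟨_, hz0⟩ := Subtype.ext hty
  exact ht

end

theorem FWDifferentials.span_range_w (p : ℕ) (A : Type u) [CommRing A] :
    Submodule.span A (Set.range (FWDifferentials.w p : A → FWDifferentials p A)) = ⊤ := by
  have h : Set.range (FWDifferentials.w p : A → FWDifferentials p A)
      = (relations p A).mkQ '' Set.range fun a => Finsupp.single a (1 : A) := by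
    rw [← Set.range_comp]
    rfl
  have h' := congrArg (Submodule.map (relations p A).mkQ)
    (Finsupp.basisSingleOne (R := A) (ι := A)).span_eq
  rw [Submodule.map_span, Submodule.map_top, Submodule.range_mkQ, Finsupp.coe_basisSingleOne] at h'
  rw [h]
  exact h'

/-! ### Linear maps out of H₁ and the isomorphism. -/

section

variable {p : ℕ} [Fact p.Prime] {A : Type u} {E : Type v} [CommRing A] [Field E] [CharP E p]

section Algebra

variable [Algebra A E]

/-- The universal property needed for injectivity: every such d factors through the classes w(u).
Perfectness of K enters through the p-th roots in the twisted extension. -/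
theorem exists_linearMap_wClass (g : A →+* E) (hg : ∀ a, algebraMap A E a = g a ^ p)
    (K : Type v) [Field K] [CharP K p] [PerfectRing K p] [Algebra E K]
    {N : Type w} [AddCommGroup N] [Module K N] [Module E N] [IsScalarTower E K N] [Module A N]
    (hgN : ∀ (a : A) (n : N), a • n = g a • n) (d : A → N) (hd : IsFWDerivation p d) :
    ∃ L : Algebra.H1Cotangent A E →ₗ[E] N, ∀ u, L (wClass u (g u) (hg u)) = d u := by
  let S := TwistedExtension p K (d (p : A))
  let P := (Algebra.Generators.self A E).toExtension
  let D : A →+* S := hd.toTwistedExtension ((algebraMap E K).comp g) fun a n => by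
    rw [hgN, ← algebraMap_smul K, RingHom.comp_apply]
  let F : MvPolynomial E A →+* S :=
    MvPolynomial.eval₂Hom D fun e => TwistedExtension.teichmuller p _ (algebraMap E K e)
  have hF : ∀ y : P.Ring, (F y).1 = algebraMap E K (algebraMap P.Ring E y) := by
    refine RingHom.congr_fun (f := (TwistedExtension.fstHom p _).comp F)
      (g := (algebraMap E K).comp (MvPolynomial.aeval (R := A) (id : E → E)).toRingHom) ?_
    refine MvPolynomial.ringHom_ext (fun a => ?_) fun e => ?_
    · have h1 : F (MvPolynomial.C a) = D a := MvPolynomial.eval₂Hom_C _ _ _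
      change (F (MvPolynomial.C a)).1
        = algebraMap E K (MvPolynomial.aeval (R := A) (id : E → E) (MvPolynomial.C a))
      rw [h1, MvPolynomial.aeval_C, hg, map_pow]
      rfl
    · have h1 : F (MvPolynomial.X e) = _ := MvPolynomial.eval₂Hom_X' _ _ _
      change (F (MvPolynomial.X e)).1
        = algebraMap E K (MvPolynomial.aeval (R := A) (id : E → E) (MvPolynomial.X e))
      rw [h1, MvPolynomial.aeval_X]
      rfl
  have hF0 : ∀ y : P.ker, (F (y : P.Ring)).1 = 0 := fun y => by
    rw [hF, show algebraMap P.Ring E y = 0 from y.2, map_zero]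
  let : Module P.Ring N := Module.compHom N (algebraMap P.Ring E)
  have : IsScalarTower P.Ring E N := IsScalarTower.of_algebraMap_smul fun _ _ => rfl
  -- Elements of I have first component 0 under F, so F(r) acts on their second component only
  -- through the image of r in E. Thus the second component is linear on I, and it kills I² because
  -- I acts as zero on N.
  have hmul : ∀ (r : P.Ring) (y : P.ker), (F (r * y : P.Ring)).2 = r • (F (y : P.Ring)).2 := by
    intro r y
    have h : F (r * y : P.Ring) = F r * F (y : P.Ring) := map_mul F r y
    rw [h, TwistedExtension.snd_mul, hF0, zero_smul, add_zero, hF, algebraMap_smul]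
    rfl
  let ℓ : P.ker →ₗ[P.Ring] N :=
    { toFun := fun y => (F (y : P.Ring)).2
      map_add' := fun y z => by
        have h : F (y + z : P.Ring) = F (y : P.Ring) + F (z : P.Ring) := map_add F _ _
        change (F (y + z : P.Ring)).2 = _
        rw [h, TwistedExtension.snd_add, hF0, TwistedExtension.cocycle_zero_left, zero_smul,
          sub_zero]
      map_smul' := hmul }
  let ℓ' : P.Cotangent →ₗ[E] N :=
    (Ideal.Cotangent.lift ℓ (fun y z => by
      change (F (y * z : P.Ring)).2 = 0
      rw [hmul]
      change algebraMap P.Ring E y • _ = (0 : N)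
      rw [show algebraMap P.Ring E y = 0 from y.2, zero_smul]) ∘ₗ
      (Algebra.Extension.cotangentEquivCotangentKer (P := P)).toLinearMap).extendScalarsOfSurjective
        P.algebraMap_surjective
  refine ⟨ℓ' ∘ₗ Algebra.Extension.h1Cotangentι, fun a => ?_⟩
  have h1 : F (MvPolynomial.C a) = D a := MvPolynomial.eval₂Hom_C _ _ _
  have h2 : F (MvPolynomial.X (g a)) = _ := MvPolynomial.eval₂Hom_X' _ _ _
  let z : S := ((0, d a) : K × N)
  -- Written as a sum so that subtracting the Teichmüller lift of g(a)^p leaves (0, d(a)) without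
  -- computing a negative in the twisted ring.
  have h3 : D a = z
      + TwistedExtension.teichmuller p (d (p : A)) (algebraMap E K (g a) ^ p) := by
    refine TwistedExtension.ext p ?_ ?_
    · exact (zero_add _).symm
    · rw [TwistedExtension.snd_add]
      change d a = d a + 0 - TwistedExtension.cocycle p 0 _ • _
      rw [TwistedExtension.cocycle_zero_left, zero_smul, sub_zero, add_zero]
  have h4 : F (MvPolynomial.C a - MvPolynomial.X (g a) ^ p) = z := by
    rw [map_sub, map_pow, h1, h2, ← map_pow, h3, add_sub_cancel_right]
  exact congrArg (fun s : S => s.2) h4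

theorem span_wClass_eq_top (g : A →+* E) (hg : ∀ a, algebraMap A E a = g a ^ p) :
    Submodule.span E (Set.range fun u => wClass u (g u) (hg u)) = ⊤ :=
  span_extClass_eq_top g hg (Algebra.Generators.self A E).toExtension
    (fun e => (MvPolynomial.X e : MvPolynomial E A)) (MvPolynomial.aeval_X (R := A) (id : E → E))

end Algebra

variable (p A E) [Algebra A E]

theorem span_frobeniusH1_w_eq_top :
    Submodule.span E (Set.range (FrobeniusH1.w p E : A → FrobeniusH1 p A E)) = ⊤ :=
  -- The original map is named before the Frobenius-twisted algebra structure shadows it.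
  let g := algebraMap A E
  let := ((frobenius E p).comp (algebraMap A E)).toAlgebra
  span_wClass_eq_top g fun _ => rfl

theorem exists_linearMap_frobeniusH1_w (K : Type v) [Field K] [CharP K p] [PerfectRing K p]
    [Algebra E K] {N : Type w} [AddCommGroup N] [Module K N] [Module E N] [IsScalarTower E K N]
    [Module A N] [IsScalarTower A E N] (d : A → N) (hd : IsFWDerivation p d) :
    ∃ L : FrobeniusH1 p A E →ₗ[E] N, ∀ u, L (FrobeniusH1.w p E u) = d u :=
  have hN : ∀ (a : A) (n : N), a • n = algebraMap A E a • n := fun a n => (algebraMap_smul E a n).symm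
  let g := algebraMap A E
  let := ((frobenius E p).comp (algebraMap A E)).toAlgebra
  exists_linearMap_wClass g (fun _ => rfl) K hN d hd

theorem toFrobeniusH1_surjective : Function.Surjective (toFrobeniusH1 p A E) := by
  rw [← LinearMap.range_eq_top, eq_top_iff, ← span_frobeniusH1_w_eq_top, Submodule.span_le]
  rintro _ ⟨a, rfl⟩
  exact ⟨1 ⊗ₜ FWDifferentials.w p a, by rw [toFrobeniusH1_tmul, one_smul]⟩

theorem toFrobeniusH1_injective : Function.Injective (toFrobeniusH1 p A E) := by
  let K := AlgebraicClosure E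
  have : CharP K p := charP_of_injective_algebraMap (algebraMap E K).injective p
  have : PerfectRing K p := PerfectField.toPerfectRing p
  -- E need not be perfect, so the derivation is taken with values over K, and an E-linear
  -- retraction brings the result back to E.
  obtain ⟨r, hr⟩ := (Algebra.linearMap E K).exists_leftInverse_of_injective
    (LinearMap.ker_eq_bot.2 (algebraMap E K).injective)
  have hr1 : r 1 = 1 := by
    have h := LinearMap.congr_fun hr 1
    rwa [LinearMap.comp_apply, Algebra.linearMap_apply, map_one] at h
  have hd : IsFWDerivation p fun a : A => (1 : K) ⊗ₜ[A] FWDifferentials.w p a := by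
    constructor
    · intro a b
      rw [(FWDifferentials.isFWDerivation_w p).map_add, TensorProduct.tmul_sub,
        TensorProduct.tmul_add, TensorProduct.tmul_smul]
    · intro a b
      rw [(FWDifferentials.isFWDerivation_w p).map_mul, TensorProduct.tmul_add,
        TensorProduct.tmul_smul, TensorProduct.tmul_smul]
  obtain ⟨L, hL⟩ := exists_linearMap_frobeniusH1_w p A E K _ hd
  let ρ : K ⊗[A] FWDifferentials p A →ₗ[E] E ⊗[A] FWDifferentials p A :=
    TensorProduct.AlgebraTensorModule.map r LinearMap.id
  have h : (ρ ∘ₗ L) ∘ₗ toFrobeniusH1 p A E = LinearMap.id := by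
    refine TensorProduct.AlgebraTensorModule.curry_injective (LinearMap.ext_ring ?_)
    refine LinearMap.ext_on_range (FWDifferentials.span_range_w p A) fun a => ?_
    change ρ (L (toFrobeniusH1 p A E (1 ⊗ₜ FWDifferentials.w p a))) = 1 ⊗ₜ FWDifferentials.w p a
    rw [toFrobeniusH1_tmul, one_smul, hL, TensorProduct.AlgebraTensorModule.map_tmul, hr1,
      LinearMap.id_apply]
  exact Function.LeftInverse.injective (g := ρ ∘ₗ L) (LinearMap.congr_fun h)

/-- For every ring homomorphism `A → E` to a field of characteristic `p`, the canonical map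
`FΩ¹_A ⊗_A E → H₁(L_{E/A})` is an isomorphism. -/
theorem toFrobeniusH1_bijective : Function.Bijective (toFrobeniusH1 p A E) :=
  ⟨toFrobeniusH1_injective p A E, toFrobeniusH1_surjective p A E⟩

end

end FrobWitt

end

theorem mainTheorem10 {A : Type*} [CommRing A] [IsLocalRing A] (p : ℕ) [Fact p.Prime]
    [CharP (IsLocalRing.ResidueField A) p] :
    Function.Bijective (FrobWitt.toFrobeniusH1 p A (IsLocalRing.ResidueField A)) :=
  FrobWitt.toFrobeniusH1_bijective p A _
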